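/- Let $Q_8=\langle i,j : i^4=1,\ i^2=j^2,\ j^{-1}ij=i^{-1}\rangle$ be the quaternion group of order $8$, let $\mathbb F_2$ be the free group on two generators, and let $G=Q_8\times\mathbb F_2$ with the discrete topology. Let $X=\langle i\rangle\times\mathbb F_2$, a (closed) normal subgroup of $G$, on which $G$ acts by conjugation, $s\cdot x=sxs^{-1}$. For a topological group $G$ acting continuously on a topological space $X$, let $LUC(X,G)$ be the Banach space (supremum norm) of all bounded continuous $F:X\to\mathbb C$ for which $s\mapsto l_sF$, $(l_sF)(x)=F(s\cdot x)$, is continuous from $G$ into $(C_b(X),\|\cdot\|_\infty)$, and let $LUC(G)=LUC(G,G)$, where $G$ acts on itself by left multiplication. For $M\in LUC(X,G)^*$ and $F\in LUC(X,G)$ let $MF\in LUC(G)$ be the function $MF(s)=\langle M,l_sF\rangle$. For $m\in LUC(G)^*$ define $m\cdot M\in LUC(X,G)^*$ by $\langle m\cdot M,F\rangle=\langle m,MF\rangle$, and let $$\mathfrak Z(X,G)=\{m\in LUC(G)^* : M\mapsto m\cdot M \text{ is weak}^*\text{-to-weak}^*\text{ continuous on } LUC(X,G)^*\}.$$ Let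 $M(G)$ be the space of complex regular Borel measures on $G$, regarded as a subspace of $LUC(G)^*$ by $\langle\mu,f\rangle=\int_G f\,d\mu$. Then, for the above $G$ and $X$, $$M(G)\subsetneq\mathfrak Z(X,G)\subsetneq LUC(G)^*.$$ -/

import Mathlib

open MeasureTheory
open scoped BoundedContinuousFunction

noncomputable section

namespace LUCModule

section General

variable (X G : Type*) [TopologicalSpace X] [TopologicalSpace G] [Group G] [MulAction G X]
  [ContinuousSMul G X]

variable {X G} in
/-- The left translation `l_s F (x) = F (s • x)` of a bounded continuous function on a
`G`-space `X`. -/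
def leftTranslate (s : G) (F : X →ᵇ ℂ) : X →ᵇ ℂ :=
  F.compContinuous ⟨fun x => s • x, continuous_const_smul s⟩

variable {X G} in
@[simp]
theorem leftTranslate_apply (s : G) (F : X →ᵇ ℂ) (x : X) :
    leftTranslate s F x = F (s • x) := rfl

/-- `LUC(X, G)`: the bounded continuous complex functions `F` on the `G`-space `X` for which
`s ↦ l_s F` is continuous from `G` into `C_b(X)` with the supremum norm. -/
def LUC : Submodule ℂ (X →ᵇ ℂ) where
  carrier := {F | Continuous fun s : G => leftTranslate s F}
  zero_mem' := by
    have h : (fun s : G => leftTranslate s (0 : X →ᵇ ℂ)) = fun _ => 0 := by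
      funext s; ext x; rfl
    simp only [Set.mem_ofPred_eq, h]
    exact continuous_const
  add_mem' := by
    intro F H hF hH
    have h : (fun s : G => leftTranslate s (F + H)) =
        fun s => leftTranslate s F + leftTranslate s H := by
      funext s; ext x; rfl
    simp only [Set.mem_ofPred_eq, h]
    exact Continuous.add hF hH
  smul_mem' := by
    intro c F hF
    have h : (fun s : G => leftTranslate s (c • F)) = fun s => c • leftTranslate s F := by
      funext s; ext x; rfl
    simp only [Set.mem_ofPred_eq, h]
    exact Continuous.const_smul hF c

variable {X G}

theorem mem_LUC {F : X →ᵇ ℂ} :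
    F ∈ LUC X G ↔ Continuous fun s : G => leftTranslate s F := Iff.rfl

theorem norm_leftTranslate_le (s : G) (F : X →ᵇ ℂ) : ‖leftTranslate s F‖ ≤ ‖F‖ :=
  (BoundedContinuousFunction.norm_le (norm_nonneg F)).2 fun x => F.norm_coe_le_norm (s • x)

theorem leftTranslate_leftTranslate (s t : G) (F : X →ᵇ ℂ) :
    leftTranslate t (leftTranslate s F) = leftTranslate (s * t) F := by
  ext x
  simp [mul_smul]

variable [IsTopologicalGroup G]

/-- The translation `l_s` as a map of `LUC(X, G)` into itself. -/
def translate (s : G) (F : LUC X G) : LUC X G :=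
  ⟨leftTranslate s F.1, by
    rw [mem_LUC]
    simp only [leftTranslate_leftTranslate]
    exact (mem_LUC.1 F.2).comp (continuous_const_mul s)⟩

theorem continuous_translate (F : LUC X G) : Continuous fun s : G => translate s F :=
  Continuous.subtype_mk (mem_LUC.1 F.2) _

theorem norm_translate_le (s : G) (F : LUC X G) : ‖translate s F‖ ≤ ‖F‖ :=
  norm_leftTranslate_le s F.1

theorem norm_apply_translate_le (M : StrongDual ℂ (LUC X G)) (F : LUC X G) (s : G) :
    ‖M (translate s F)‖ ≤ ‖M‖ * ‖F‖ :=
  (M.le_opNorm _).trans (mul_le_mul_of_nonneg_left (norm_translate_le s F) (norm_nonneg M))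

/-- The function `MF (s) = ⟨M, l_s F⟩` on `G`, as a bounded continuous function. -/
def orbitBCF (M : StrongDual ℂ (LUC X G)) (F : LUC X G) : G →ᵇ ℂ :=
  BoundedContinuousFunction.ofNormedAddCommGroup (fun s => M (translate s F))
    (M.continuous.comp (continuous_translate F)) (‖M‖ * ‖F‖) (norm_apply_translate_le M F)

theorem norm_orbitBCF_le (M : StrongDual ℂ (LUC X G)) (F : LUC X G) :
    ‖orbitBCF M F‖ ≤ ‖M‖ * ‖F‖ :=
  (BoundedContinuousFunction.norm_le (by positivity)).2 (norm_apply_translate_le M F)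

theorem leftTranslate_orbitBCF (M : StrongDual ℂ (LUC X G)) (F : LUC X G) (s : G) :
    leftTranslate s (orbitBCF M F) = orbitBCF M (translate s F) := by
  ext t
  have h : translate (s * t) F = translate t (translate s F) :=
    Subtype.ext (leftTranslate_leftTranslate s t F.1).symm
  exact congrArg M h

theorem orbitBCF_mem (M : StrongDual ℂ (LUC X G)) (F : LUC X G) :
    orbitBCF M F ∈ LUC G G := by
  rw [mem_LUC, continuous_iff_continuousAt]
  intro s₀
  simp only [leftTranslate_orbitBCF]
  rw [ContinuousAt, tendsto_iff_norm_sub_tendsto_zero]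
  have h0 : Filter.Tendsto (fun s : G => ‖M‖ * ‖translate s F - translate s₀ F‖) (nhds s₀)
      (nhds 0) := by
    have h := tendsto_iff_norm_sub_tendsto_zero.1 ((continuous_translate F).tendsto s₀)
    rw [← mul_zero ‖M‖]
    exact h.const_mul ‖M‖
  refine squeeze_zero (fun _ => norm_nonneg _) (fun s => ?_) h0
  have hsub : orbitBCF M (translate s F) - orbitBCF M (translate s₀ F) =
      orbitBCF M (translate s F - translate s₀ F) := by
    ext t
    exact (map_sub M (translate t (translate s F)) (translate t (translate s₀ F))).symm
  rw [hsub]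
  exact norm_orbitBCF_le M _

/-- The element `MF` of `LUC(G) = LUC(G, G)`, where `G` acts on itself by left multiplication:
`MF (s) = ⟨M, l_s F⟩`. -/
def orbit (M : StrongDual ℂ (LUC X G)) (F : LUC X G) : LUC G G :=
  ⟨orbitBCF M F, orbitBCF_mem M F⟩

@[simp]
theorem orbit_apply (M : StrongDual ℂ (LUC X G)) (F : LUC X G) (s : G) :
    (orbit M F : G →ᵇ ℂ) s = M (translate s F) := rfl

/-- The left module action of `LUC(G)^*` on `LUC(X, G)^*`: `⟨m · M, F⟩ = ⟨m, MF⟩`. -/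
def dualAct (m : StrongDual ℂ (LUC G G)) (M : StrongDual ℂ (LUC X G)) :
    StrongDual ℂ (LUC X G) :=
  LinearMap.mkContinuous
    { toFun := fun F => m (orbit M F)
      map_add' := fun F H => by
        rw [← map_add]
        congr 1
        ext s
        exact map_add M (translate s F) (translate s H)
      map_smul' := fun c F => by
        rw [RingHom.id_apply, ← map_smul]
        congr 1
        ext s
        exact map_smul M c (translate s F) }
    (‖m‖ * ‖M‖) (fun F => by
      rw [mul_assoc]
      exact (m.le_opNorm _).trans
        (mul_le_mul_of_nonneg_left (norm_orbitBCF_le M F) (norm_nonneg m)))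

@[simp]
theorem dualAct_apply (m : StrongDual ℂ (LUC G G)) (M : StrongDual ℂ (LUC X G)) (F : LUC X G) :
    dualAct m M F = m (orbit M F) := rfl

variable (X G) in
/-- The topological centre `𝔷(X, G)`: all `m ∈ LUC(G)^*` such that `M ↦ m · M` is continuous on
`LUC(X, G)^*` from the weak-star topology to the weak-star topology. -/
def topCentre : Set (StrongDual ℂ (LUC G G)) :=
  {m | Continuous fun M : WeakDual ℂ (LUC X G) =>
    StrongDual.toWeakDual (dualAct m (WeakDual.toStrongDual M))}

variable (G) in
/-- The image of `M(G)` in `LUC(G)^*`: the functionals `f ↦ ∫ f dμ`, where `μ` is a complex Borel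
measure on `G` whose total variation measure is regular. -/
def measureFunctionals [MeasurableSpace G] [BorelSpace G] : Set (StrongDual ℂ (LUC G G)) :=
  {m | ∃ μ : ComplexMeasure G, μ.variation.Regular ∧
    ∀ f : LUC G G, m f = ∫ᵛ s, (f : G →ᵇ ℂ) s ∂[ContinuousLinearMap.mul ℝ ℂ; μ]}

end General

section Conjugation

/-- The underlying space of a normal subgroup `N` of `G`, with the subspace topology, regarded as
a `G`-space under conjugation. -/
def ConjSpace {G : Type*} [Group G] (N : Subgroup G) : Type _ := N

variable {G : Type*} [Group G] (N : Subgroup G)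

instance [TopologicalSpace G] : TopologicalSpace (ConjSpace N) :=
  inferInstanceAs (TopologicalSpace N)

/-- `s • x = s * x * s⁻¹`. -/
instance [N.Normal] : MulAction G (ConjSpace N) where
  smul s x := ⟨s * x.1 * s⁻¹, Subgroup.Normal.conj_mem inferInstance x.1 x.2 s⟩
  one_smul x := Subtype.ext (show 1 * x.1 * 1⁻¹ = x.1 by group)
  mul_smul s t x := Subtype.ext
    (show s * t * x.1 * (s * t)⁻¹ = s * (t * x.1 * t⁻¹) * s⁻¹ by group)

theorem ConjSpace.coe_smul [N.Normal] (s : G) (x : ConjSpace N) :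
    (s • x).1 = s * x.1 * s⁻¹ := rfl

instance [TopologicalSpace G] [IsTopologicalGroup G] [N.Normal] :
    ContinuousSMul G (ConjSpace N) where
  continuous_smul := by
    have h : Continuous fun p : G × ConjSpace N => p.2.1 :=
      continuous_subtype_val.comp continuous_snd
    exact Continuous.subtype_mk ((continuous_fst.mul h).mul continuous_fst.inv) _

end Conjugation

section Example

/-- The direct product of the quaternion group of order eight, with `i = QuaternionGroup.a 1` and
`j = QuaternionGroup.xa 0`, and the free group on two generators. -/
abbrev Q8F2 : Type := QuaternionGroup 2 × FreeGroup (Fin 2)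

instance : TopologicalSpace Q8F2 := ⊥

instance : DiscreteTopology Q8F2 := ⟨rfl⟩

instance : MeasurableSpace Q8F2 := borel Q8F2

instance : BorelSpace Q8F2 := ⟨rfl⟩

/-- The subgroup `⟨i⟩ × 𝔽₂` of `Q₈ × 𝔽₂`. -/
def subgroupI : Subgroup Q8F2 :=
  (Subgroup.zpowers (QuaternionGroup.a 1 : QuaternionGroup 2)).prod ⊤

theorem zpowers_normal : (Subgroup.zpowers (QuaternionGroup.a 1 : QuaternionGroup 2)).Normal := by
  constructor
  have key : ∀ g : QuaternionGroup 2,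
      g * QuaternionGroup.a 1 * g⁻¹ = QuaternionGroup.a 1 ∨
      g * QuaternionGroup.a 1 * g⁻¹ = (QuaternionGroup.a 1)⁻¹ := by decide
  rintro _ ⟨k, rfl⟩ g
  change g * QuaternionGroup.a 1 ^ k * g⁻¹ ∈ _
  rw [← conj_zpow]
  refine Subgroup.zpow_mem _ ?_ k
  rcases key g with h | h <;> rw [h]
  · exact Subgroup.mem_zpowers _
  · exact Subgroup.inv_mem _ (Subgroup.mem_zpowers _)

instance : subgroupI.Normal := by
  have := zpowers_normal
  unfold subgroupI
  exact Subgroup.prod_normal _ _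

end Example

end LUCModule

end

/-! Since `G` is countable and discrete, every bounded function is in `LUC` and a complex measure is
an absolutely summable family of point masses. Then `⟨μ, MF⟩ = ∑ μ{s} M(l_s F) = M(∑ μ{s} l_s F)` is
evaluation of `M` at a fixed function, so measures lie in the centre.

First strictness: `z = (i, 1)` acts trivially on `X`, so `MF(sz) = MF(s)` for all `M`, `F`. The
difference of limits of evaluations along `g n * z` and `g n` kills every `MF`, hence is in the
centre, but is nonzero and has no point masses.

Second strictness: weak-star continuity would force the iterated limits of `F (g n • x k)` to agree.
Conjugation in the free group supplies an `F` whose values are the indicator of `k < n`, with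
iterated limits 1 and 0. -/

open Filter Topology

noncomputable section

namespace LUCModule

/-! ### Complex measures on countable discrete spaces as sums of point masses. -/

section ComplexMeasure

variable {S : Type*} [MeasurableSpace S] [Countable S] [MeasurableSingletonClass S]

theorem summable_apply_singleton (μ : ComplexMeasure S) : Summable fun s => μ {s} :=
  (VectorMeasure.hasSum_of_disjoint_iUnion (v := μ) (fun s => measurableSet_singleton s)
    fun _ _ h => Set.disjoint_singleton.2 h).summable

/-- A complex measure on a countable discrete measurable space has finite total variation. -/
theorem isFiniteMeasure_variation (μ : ComplexMeasure S) : IsFiniteMeasure μ.variation := by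
  set ν : Measure S := Measure.sum fun s => ‖μ {s}‖ₑ • Measure.dirac s with hν
  -- The variation is the least measure dominating `‖μ E‖ₑ`, and countable additivity over points
  -- shows that `ν` dominates it.
  have hle : μ.variation ≤ ν := by
    refine VectorMeasure.variation_le_of_forall_enorm_le fun E _ => ?_
    have hE : E = ⋃ x : E, {x.1} := by ext; simp
    have hd : Pairwise (Function.onFun Disjoint fun x : E => ({x.1} : Set S)) :=
      fun x y h => Set.disjoint_singleton.2 fun h' => h (Subtype.ext h')
    rw [hE, VectorMeasure.of_disjoint_iUnion (fun x : E => measurableSet_singleton x.1) hd,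
      measure_iUnion hd fun x : E => measurableSet_singleton x.1]
    refine enorm_tsum_le_tsum_enorm.trans (ENNReal.tsum_le_tsum fun x => ?_)
    calc ‖μ {x.1}‖ₑ = (‖μ {x.1}‖ₑ • Measure.dirac x.1) {x.1} := by simp
      _ ≤ ν {x.1} := Measure.le_sum (fun s => ‖μ {s}‖ₑ • Measure.dirac s) x.1 {x.1}
  refine ⟨(hle Set.univ).trans_lt ?_⟩
  have h := (summable_apply_singleton μ).norm
  have h2 : ν Set.univ = ∑' s, ‖μ {s}‖ₑ := by simp [hν]
  rw [h2]
  exact (ENNReal.tsum_coe_ne_top_iff_summable.2 (NNReal.summable_coe.1 h)).lt_top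

theorem hasSum_integral_singleton [TopologicalSpace S] [OpensMeasurableSpace S]
    (μ : ComplexMeasure S) (f : S →ᵇ ℂ) :
    HasSum (fun s => f s * μ {s}) (∫ᵛ s, f s ∂[ContinuousLinearMap.mul ℝ ℂ; μ]) := by
  have := isFiniteMeasure_variation μ
  have hf : μ.Integrable f :=
    Integrable.of_bound f.continuous.aestronglyMeasurable ‖f‖
      (Eventually.of_forall f.norm_coe_le_norm)
  have hU : (⋃ s : S, ({s} : Set S)) = Set.univ := Set.iUnion_of_singleton S
  have h := VectorMeasure.hasSum_setIntegral_iUnion (μ := μ) (f := f)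
    (B := ContinuousLinearMap.mul ℝ ℂ) (s := fun s : S => ({s} : Set S))
    (fun s => measurableSet_singleton s) (fun _ _ h => Set.disjoint_singleton.2 h)
    (by rw [hU]; simpa [VectorMeasure.IntegrableOn] using hf)
  rw [hU, VectorMeasure.restrict_univ] at h
  have e (s : S) : ∫ᵛ x in {s}, f x ∂[ContinuousLinearMap.mul ℝ ℂ; μ] = f s * μ {s} := by
    rw [VectorMeasure.setIntegral_congr_fun
      (g := fun _ => f s) (fun x hx => by rw [Set.mem_singleton_iff.1 hx]),
      VectorMeasure.setIntegral_const]
    rfl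
  simpa only [e] using h

end ComplexMeasure

/-! ### Criteria for membership and non-membership in the topological centre. -/

section General

variable {X G : Type*} [TopologicalSpace X] [TopologicalSpace G] [Group G] [MulAction G X]
  [ContinuousSMul G X]

theorem mem_LUC_of_discrete [DiscreteTopology G] (F : X →ᵇ ℂ) : F ∈ LUC X G :=
  mem_LUC.2 continuous_of_discreteTopology

variable (G) in
/-- The indicator function of a subset of a discrete `G`-space, as an element of `LUC(X, G)`. -/
def indicatorLUC [DiscreteTopology X] [DiscreteTopology G] (A : Set X) : LUC X G :=
  ⟨BoundedContinuousFunction.ofNormedAddCommGroup (A.indicator fun _ => (1 : ℂ))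
    continuous_of_discreteTopology 1 fun x => by
      by_cases h : x ∈ A <;> simp [h], mem_LUC_of_discrete _⟩

theorem indicatorLUC_of_mem [DiscreteTopology X] [DiscreteTopology G] {A : Set X} {x : X}
    (h : x ∈ A) : (indicatorLUC G A : X →ᵇ ℂ) x = 1 :=
  Set.indicator_of_mem h fun _ => (1 : ℂ)

theorem indicatorLUC_of_notMem [DiscreteTopology X] [DiscreteTopology G] {A : Set X} {x : X}
    (h : x ∉ A) : (indicatorLUC G A : X →ᵇ ℂ) x = 0 :=
  Set.indicator_of_notMem h fun _ => (1 : ℂ)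

variable (X G) in
/-- Evaluation at a point, as a functional on `LUC(X, G)`. -/
def evalLUC (x : X) : StrongDual ℂ (LUC X G) :=
  (BoundedContinuousFunction.evalCLM ℂ x).comp (LUC X G).subtypeL

@[simp]
theorem evalLUC_apply (x : X) (F : LUC X G) : evalLUC X G x F = (F : X →ᵇ ℂ) x := rfl

theorem norm_evalLUC_le (x : X) : ‖evalLUC X G x‖ ≤ 1 :=
  ContinuousLinearMap.opNorm_le_bound _ zero_le_one fun F => by
    rw [one_mul]
    exact F.1.norm_coe_le_norm x

/-- Every sequence of points has a weak-star limit along a given ultrafilter. -/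
theorem exists_tendsto_ultrafilter (p : Ultrafilter ℕ) (x : ℕ → X) :
    ∃ M : StrongDual ℂ (LUC X G),
      ∀ F : LUC X G, Tendsto (fun n => (F : X →ᵇ ℂ) (x n)) p (𝓝 (M F)) := by
  have hc := WeakDual.isCompact_closedBall (𝕜 := ℂ) (E := LUC X G) 0 1
  obtain ⟨M, -, hM⟩ := hc.ultrafilter_le_nhds
    (p.map fun n => StrongDual.toWeakDual (evalLUC X G (x n)))
    (by
      rw [le_principal_iff]
      refine Filter.mem_map.2 (Eventually.of_forall fun n => ?_)
      exact mem_closedBall_zero_iff.2 (norm_evalLUC_le (x n)))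
  refine ⟨WeakDual.toStrongDual M, fun F => ?_⟩
  exact ((WeakDual.eval_continuous F).tendsto M).comp hM

variable [IsTopologicalGroup G]

theorem mem_topCentre_iff {m : StrongDual ℂ (LUC G G)} :
    m ∈ topCentre X G ↔
      ∀ F : LUC X G, Continuous fun M : WeakDual ℂ (LUC X G) =>
        m (orbit (WeakDual.toStrongDual M) F) :=
  ⟨fun h F => (WeakDual.eval_continuous F).comp h, fun h =>
    WeakDual.continuous_of_continuous_eval h⟩

/-- For a countable discrete group, the measures lie in the topological centre. -/
theorem measureFunctionals_subset_topCentre [DiscreteTopology G] [Countable G]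
    [MeasurableSpace G] [BorelSpace G] : measureFunctionals G ⊆ topCentre X G := by
  rintro m ⟨μ, -, hμ⟩
  refine mem_topCentre_iff.2 fun F => ?_
  -- The sum is taken in the complete space of bounded continuous functions; discreteness of `G`
  -- puts its value back in `LUC`.
  have hs : Summable fun s : G => μ {s} • (translate s F).1 := by
    refine Summable.of_norm_bounded ((summable_apply_singleton μ).norm.mul_right ‖F‖) fun s => ?_
    rw [norm_smul]
    exact mul_le_mul_of_nonneg_left (norm_translate_le s F) (norm_nonneg _)
  obtain ⟨H, hH⟩ := hs
  have hH' : HasSum (fun s : G => μ {s} • translate s F) ⟨H, mem_LUC_of_discrete H⟩ :=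
    (IsInducing.subtypeVal.hasSum_iff (g := (LUC X G).subtype) _ _).1 hH
  have key : ∀ M : StrongDual ℂ (LUC X G), m (orbit M F) = M ⟨H, mem_LUC_of_discrete H⟩ := by
    intro M
    rw [hμ]
    refine (hasSum_integral_singleton μ _).unique ?_
    have e (s : G) : M (μ {s} • translate s F) = (orbit M F).1 s * μ {s} := by
      rw [map_smul, smul_eq_mul, mul_comm]
      rfl
    have h := M.hasSum hH'
    simp only [e] at h
    exact h
  simp only [key]
  exact WeakDual.eval_continuous _

/-- Functionals vanishing on all functions `MF` lie in the topological centre. -/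
theorem mem_topCentre_of_orbit_eq_zero {m : StrongDual ℂ (LUC G G)}
    (h : ∀ (M : StrongDual ℂ (LUC X G)) (F : LUC X G), m (orbit M F) = 0) :
    m ∈ topCentre X G :=
  mem_topCentre_iff.2 fun F => by
    simp only [h]
    exact continuous_const

/-- If some element `z` acts trivially on `X` and `G` contains a sequence whose terms, together
with their translates by `z`, are pairwise distinct, then the topological centre contains
functionals that are not measures. -/
theorem exists_mem_topCentre_notMem_measureFunctionals [DiscreteTopology G] [Countable G]
    [MeasurableSpace G] [BorelSpace G] {z : G} (hz : ∀ x : X, z • x = x) {g : ℕ → G}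
    (hg : Function.Injective g) (hzg : ∀ k n, g k * z ≠ g n) :
    ∃ m ∈ topCentre X G, m ∉ measureFunctionals G := by
  obtain ⟨m₁, h₁⟩ := exists_tendsto_ultrafilter (G := G) (hyperfilter ℕ) fun n => g n * z
  obtain ⟨m₂, h₂⟩ := exists_tendsto_ultrafilter (G := G) (hyperfilter ℕ) g
  refine ⟨m₁ - m₂, mem_topCentre_of_orbit_eq_zero fun M F => ?_, ?_⟩
  -- As `z` fixes `X` pointwise, `MF` takes equal values at `g n * z` and `g n`.
  · rw [sub_apply, sub_eq_zero]
    refine tendsto_nhds_unique (h₁ (orbit M F)) ((h₂ (orbit M F)).congr fun n => ?_)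
    have h : translate (g n * z) F = translate (g n) F := by
      refine Subtype.ext (BoundedContinuousFunction.ext fun x => ?_)
      change F.1 ((g n * z) • x) = F.1 (g n • x)
      rw [mul_smul, hz]
    rw [orbit_apply, orbit_apply, h]
  · rintro ⟨μ, -, hμ⟩
    have hsum : ∀ f : LUC G G, HasSum (fun s => f.1 s * μ {s}) ((m₁ - m₂) f) := fun f => by
      rw [hμ f]
      exact hasSum_integral_singleton μ f.1
    -- An injective sequence visits each point finitely often, so a free ultrafilter sees no point
    -- mass.
    have hlim : ∀ {u : ℕ → G}, Function.Injective u → ∀ s : G,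
        Tendsto (fun n => (indicatorLUC G {s}).1 (u n)) (hyperfilter ℕ) (𝓝 0) := by
      intro u hu s
      refine tendsto_const_nhds.congr' ?_
      have hfin : (u ⁻¹' {s}).Finite := (Set.finite_singleton s).preimage hu.injOn
      filter_upwards [compl_mem_hyperfilter_of_finite hfin] with n hn
      exact (indicatorLUC_of_notMem (G := G) (A := {s}) hn).symm
    have hzero : ∀ s, μ {s} = 0 := by
      intro s
      have e₁ : m₁ (indicatorLUC G {s}) = 0 := tendsto_nhds_unique (h₁ _)
        (hlim (u := fun n => g n * z) (fun _ _ h => hg (mul_right_cancel h)) s)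
      have e₂ : m₂ (indicatorLUC G {s}) = 0 := tendsto_nhds_unique (h₂ _) (hlim hg s)
      have h := hsum (indicatorLUC G {s})
      rw [sub_apply, e₁, e₂, sub_zero] at h
      have h' := hasSum_single (f := fun t => (indicatorLUC G {s}).1 t * μ {t}) s
        fun t ht => by
          change (indicatorLUC G {s}).1 t * _ = 0
          rw [indicatorLUC_of_notMem (by simpa using ht), zero_mul]
      have := h'.unique h
      rwa [indicatorLUC_of_mem (Set.mem_singleton s), one_mul] at this
    -- Without point masses a measure gives 0 on this indicator, but `m₁ - m₂` gives `-1`.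
    have e₁ : m₁ (indicatorLUC G (Set.range g)) = 0 :=
      tendsto_nhds_unique (h₁ _) (tendsto_const_nhds.congr fun n =>
        (indicatorLUC_of_notMem (by rintro ⟨k, hk⟩; exact hzg n k hk.symm)).symm)
    have e₂ : m₂ (indicatorLUC G (Set.range g)) = 1 :=
      tendsto_nhds_unique (h₂ _) (tendsto_const_nhds.congr fun n =>
        (indicatorLUC_of_mem (Set.mem_range_self n)).symm)
    have h := hsum (indicatorLUC G (Set.range g))
    simp only [hzero, mul_zero] at h
    have := h.unique hasSum_zero
    rw [sub_apply, e₁, e₂] at this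
    norm_num at this

/-- If the iterated limits of `F (g n • x k)` can be made to differ, then the topological centre
is not the whole of `LUC(G)^*`. -/
theorem exists_notMem_topCentre {g : ℕ → G} {x : ℕ → X} {F : LUC X G}
    (h1 : ∀ n k, k < n → (F : X →ᵇ ℂ) (g n • x k) = 1)
    (h0 : ∀ n k, n ≤ k → (F : X →ᵇ ℂ) (g n • x k) = 0) :
    ∃ m : StrongDual ℂ (LUC G G), m ∉ topCentre X G := by
  obtain ⟨m, hm⟩ := exists_tendsto_ultrafilter (G := G) (hyperfilter ℕ) g
  obtain ⟨M, hM⟩ := exists_tendsto_ultrafilter (G := G) (hyperfilter ℕ) x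
  refine ⟨m, fun hmem => ?_⟩
  have hc := mem_topCentre_iff.1 hmem F
  have hx : Tendsto (fun k => StrongDual.toWeakDual (evalLUC X G (x k))) (hyperfilter ℕ)
      (𝓝 (StrongDual.toWeakDual M)) :=
    tendsto_iff_forall_eval_tendsto_topDualPairing.2 hM
  have hlim := (hc.tendsto _).comp hx
  -- Limit over `n` at fixed `k`; `hM0` takes the limit over `k` at fixed `n`. Only `hlim` uses the
  -- assumed continuity.
  have hone : ∀ k, m (orbit (evalLUC X G (x k)) F) = 1 := fun k =>
    tendsto_nhds_unique (hm _) (tendsto_const_nhds.congr'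
      (Nat.hyperfilter_le_atTop ((eventually_gt_atTop k).mono fun n hn => (h1 n k hn).symm)))
  have hM0 : ∀ n, M (translate (g n) F) = 0 := fun n =>
    tendsto_nhds_unique (hM _) (tendsto_const_nhds.congr'
      (Nat.hyperfilter_le_atTop ((eventually_ge_atTop n).mono fun k hk => (h0 n k hk).symm)))
  have hzero : m (orbit M F) = 0 :=
    tendsto_nhds_unique (hm _) (tendsto_const_nhds.congr fun n => (hM0 n).symm)
  have e : (1 : ℂ) = m (orbit M F) :=
    tendsto_nhds_unique (tendsto_const_nhds.congr fun k => (hone k).symm) hlim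
  rw [hzero] at e
  exact one_ne_zero e

end General

/-! ### The group `Q₈ × 𝔽₂` acting on `⟨i⟩ × 𝔽₂`. -/

section Example

instance : DiscreteTopology (ConjSpace subgroupI) :=
  inferInstanceAs (DiscreteTopology subgroupI)

/-- The representation of the free group by affine permutations of the rational line that sends
the generators to `t ↦ t + 1` and `t ↦ t * 2`. -/
def affineRep : FreeGroup (Fin 2) →* Equiv.Perm ℚ :=
  FreeGroup.lift ![Equiv.addRight 1, Equiv.mulRight₀ 2 two_ne_zero]

theorem affineRep_of_zero_pow (m : ℕ) (t : ℚ) :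
    affineRep (FreeGroup.of 0 ^ m) t = t + m := by
  induction m with
  | zero => simp
  | succ m ih =>
    rw [pow_succ', map_mul, Equiv.Perm.mul_apply, ih]
    simp [affineRep, add_assoc]

theorem affineRep_of_one_pow (n : ℕ) (t : ℚ) :
    affineRep (FreeGroup.of 1 ^ n) t = t * 2 ^ n := by
  induction n with
  | zero => simp
  | succ n ih =>
    rw [pow_succ', map_mul, Equiv.Perm.mul_apply, ih]
    simp [affineRep, pow_succ, mul_assoc]

/-- Scaling fixes 0, so only the translation by `m` and the outer scaling contribute. -/
theorem affineRep_conj_apply_zero (n m : ℕ) :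
    affineRep (FreeGroup.of 1 ^ n * FreeGroup.of 0 ^ m * (FreeGroup.of 1 ^ n)⁻¹) 0
      = ((2 ^ n * m : ℕ) : ℚ) := by
  have h : affineRep (FreeGroup.of 1 ^ n)⁻¹ 0 = 0 := by
    rw [map_inv, Equiv.Perm.inv_eq_iff_eq, affineRep_of_one_pow, zero_mul]
  rw [map_mul, map_mul, Equiv.Perm.mul_apply, Equiv.Perm.mul_apply, h, affineRep_of_zero_pow,
    affineRep_of_one_pow]
  push_cast
  ring

/-- The element `(1, w)` of `⟨i⟩ × 𝔽₂`. -/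
def freePoint (w : FreeGroup (Fin 2)) : ConjSpace subgroupI :=
  ⟨(1, w), Subgroup.mem_prod.2 ⟨one_mem _, Subgroup.mem_top _⟩⟩

theorem smul_freePoint (v w : FreeGroup (Fin 2)) :
    ((1, v) : Q8F2) • freePoint w = freePoint (v * w * v⁻¹) :=
  Subtype.ext <| by
    rw [ConjSpace.coe_smul]
    simp [freePoint]

theorem exists_notMem_topCentre_example :
    ∃ m, m ∉ topCentre (ConjSpace subgroupI) Q8F2 := by
  have hval : ∀ n k : ℕ, padicValNat 2 (2 ^ n * 3 ^ k) = n ∧ padicValNat 3 (2 ^ n * 3 ^ k) = k := by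
    intro n k
    have : Fact (Nat.Prime 3) := ⟨Nat.prime_three⟩
    constructor
    · rw [padicValNat.mul (by positivity) (by positivity), padicValNat.prime_pow,
        padicValNat.pow, padicValNat_primes (by norm_num)]
      simp
    · rw [padicValNat.mul (by positivity) (by positivity), padicValNat.prime_pow,
        padicValNat.pow, padicValNat_primes (by norm_num)]
      simp
  -- With `m = 3 ^ k` the conjugate sends 0 to `2 ^ n * 3 ^ k`, whose valuations recover `n` and
  -- `k`; membership in `A` then reads `k < n`.
  let A : Set (ConjSpace subgroupI) :=
    {x | ∃ N : ℕ, affineRep x.1.2 0 = N ∧ padicValNat 3 N < padicValNat 2 N}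
  have hA : ∀ n k : ℕ, ((1, FreeGroup.of 1 ^ n) : Q8F2) • freePoint (FreeGroup.of 0 ^ 3 ^ k) ∈ A ↔
      k < n := by
    intro n k
    have h : affineRep (freePoint (FreeGroup.of 1 ^ n * FreeGroup.of 0 ^ 3 ^ k *
        (FreeGroup.of 1 ^ n)⁻¹)).1.2 0 = _ := affineRep_conj_apply_zero n (3 ^ k)
    rw [smul_freePoint]
    simp only [A, Set.mem_ofPred_eq, h, Nat.cast_inj, exists_eq_left', (hval n k).1,
      (hval n k).2]
  exact exists_notMem_topCentre (F := indicatorLUC Q8F2 A)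
    (g := fun n => (1, FreeGroup.of 1 ^ n)) (x := fun k => freePoint (FreeGroup.of 0 ^ 3 ^ k))
    (fun n k h => indicatorLUC_of_mem ((hA n k).2 h))
    (fun n k h => indicatorLUC_of_notMem fun h' => absurd ((hA n k).1 h') (not_lt.2 h))

/-- `⟨i⟩` is abelian and the free coordinate of the acting element is trivial. -/
theorem a_one_smul (x : ConjSpace subgroupI) :
    ((QuaternionGroup.a 1, 1) : Q8F2) • x = x := by
  obtain ⟨⟨q, w⟩, hq, -⟩ := x
  obtain ⟨k, rfl⟩ := Subgroup.mem_zpowers_iff.1 hq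
  refine Subtype.ext (Prod.ext ?_ ?_)
  · change QuaternionGroup.a 1 * QuaternionGroup.a 1 ^ k * (QuaternionGroup.a 1)⁻¹ = _
    rw [(Commute.refl (QuaternionGroup.a 1 : QuaternionGroup 2)).zpow_right k |>.eq,
      mul_inv_cancel_right]
  · change 1 * w * 1⁻¹ = w
    simp

theorem exists_mem_topCentre_notMem_measureFunctionals_example :
    ∃ m ∈ topCentre (ConjSpace subgroupI) Q8F2, m ∉ measureFunctionals Q8F2 := by
  refine exists_mem_topCentre_notMem_measureFunctionals a_one_smul
    (g := fun n => (1, FreeGroup.of 0 ^ n)) (fun n k h => ?_) fun k n h => ?_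
  -- The image of 0 under the translations separates the powers; below, the `Q₈` coordinate
  -- separates `g k * z` from `g n`.
  · have h' := congrArg (fun s : Q8F2 => affineRep s.2 0) h
    simpa only [affineRep_of_zero_pow, zero_add, Nat.cast_inj] using h'
  · have h' : (1 : QuaternionGroup 2) * QuaternionGroup.a 1 = 1 := congrArg Prod.fst h
    exact absurd h' (by decide)

end Example

end LUCModule

end

theorem mainTheorem9 :
    LUCModule.measureFunctionals LUCModule.Q8F2 ⊂
        LUCModule.topCentre (LUCModule.ConjSpace LUCModule.subgroupI) LUCModule.Q8F2 ∧
      LUCModule.topCentre (LUCModule.ConjSpace LUCModule.subgroupI) LUCModule.Q8F2 ⊂ Set.univ := by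
  constructor
  · obtain ⟨m, hm, hm'⟩ := LUCModule.exists_mem_topCentre_notMem_measureFunctionals_example
    exact (Set.ssubset_iff_of_subset LUCModule.measureFunctionals_subset_topCentre).2 ⟨m, hm, hm'⟩
  · obtain ⟨m, hm⟩ := LUCModule.exists_notMem_topCentre_example
    exact Set.ssubset_univ_iff.2 fun h => hm (h ▸ Set.mem_univ m)
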